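/- **Model.** All integrals are over $\mathbb R_+=[0,\infty)$. A good is sold at price $p\ge 0$. (1) Demand $D:\mathbb R_+\to[0,\infty]$ is continuous and strictly decreasing, with $D(0)=\infty$ and $\lim_{p\to\infty}D(p)=0$. (2) A firm with productivity $\phi\ge0$ facing price $p\ge0$ has profit $\pi(\phi,p)\in\mathbb R$ and output $q(\phi,p)\ge 0$. Both $\pi$ and $q$ are continuous and strictly increasing on $\mathbb R_+^2$ (for the componentwise order), and $\pi(\phi,p)<0$ if $\phi=0$ or $p=0$. (3) Productivity of incumbents follows a Markov transition kernel $\Gamma$ on $\mathbb R_+$ (with $n$-step kernel $\Gamma^n$). It is monotone increasing: $\phi\mapsto\Gamma(\phi,[0,a])$ is decreasing for each $a\ge 0$. For all $a>0$ and $\phi\ge0$ there is an $n\in\mathbb N$ with $\Gamma^n(\phi,[0,a))>0$. For each $p>0$ there is a $\phi\ge0$ with $\int\pi(\phi',p)\,\Gamma(\phi,d\phi')\ge0$. (4) Entrants draw their productivity from a probability measure $\gamma$ on $\mathbb R_+$ with $\int q(\phi,p)\,\gamma(d\phi)<\infty$ for all $p\ge0$ and $\gamma([0,a])>0$ for all $a>0$.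 The cost of entry is $c_e>0$, and $\int\pi(\phi,p)\,\gamma(d\phi)\ge c_e$ for some $p>0$. (5) Let $\beta=1/(1+r)$ with $r>0$. For all $p\ge0$, a firm with zero productivity that stays in the market forever has nonpositive expected discounted profits from the following periods: $$\sum_{t\ge1}\beta^t\int\pi(\phi',p)\,\Gamma^t(0,d\phi')\le0 .$$ (6) There is a $\delta\in(\beta,1)$ such that $\sum_{t\ge0}\delta^t\int\!\int\pi(\phi',p)\,\Gamma^t(\phi,d\phi')\,\gamma(d\phi)<\infty$ for all $p\ge 0$ and $$\kappa(\phi,p):=\sum_{t\ge0}\delta^t\int(\pi(\phi',p)+b)\,\Gamma^t(\phi,d\phi')<\infty\quad\text{for all }(\phi,p)\in\mathbb R_+^2,$$ where $b:=1-\pi(0,0)$, so that $\pi+b\ge1$. Let $\mathscr C$ be the set of continuous increasing functions $u$ on $\mathbb R_+^2$ for which $|u|/\kappa$ is bounded. For each $u\in\mathscr C$, the function $(\phi,p)\mapsto\int u(\phi',p)\,\Gamma(\phi,d\phi')$ is continuous. **Equilibrium.** Let $v^*$ be the unique $v\in\mathscr C$ with $$v(\phi,p)=\pi(\phi,p)+\beta\max\Big\{0,\int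 v(\phi',p)\,\Gamma(\phi,d\phi')\Big\}\quad\text{for all }(\phi,p)\in\mathbb R_+^2,$$ and let $\bar\phi(p):=\min\{\phi\ge0:\int v^*(\phi',p)\,\Gamma(\phi,d\phi')\ge0\}$, with $\min\emptyset=\infty$. A *stationary recursive equilibrium* is a triple of a price $p>0$, a finite Borel measure $\mu$ on $\mathbb R_+$ (the distribution of firms) and a number $M\ge0$ (the mass of entrants) such that - $\int v^*(\phi,p)\,\gamma(d\phi)\le c_e$, with equality if $M>0$ (entry condition); - $\mu(B)=\int\Gamma(\phi,B)\,\mathbb 1\{\phi\ge\bar\phi(p)\}\,\mu(d\phi)+M\,\gamma(B)$ for all Borel sets $B$ (time invariance); - $M=\mu\{\phi:\phi<\bar\phi(p)\}$ (balanced entry and exit); - $\int q(\phi,p)\,\mu(d\phi)=D(p)$ (market clearing). Let $\{\phi_t\}_{t\ge1}$ be a Markov chain with $\phi_1\sim\gamma$ and $\phi_{t+1}\sim\Gamma(\phi_t,\cdot)$ for $t\ge1$; let $\tau(p):=\inf\{t\ge1:\phi_t<\bar\phi(p)\}$ be the lifespan of the firm, with $\inf\emptyset=\infty$, and let $\ell(p):=\mathbb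 E\sum_{t=1}^{\tau(p)}q(\phi_t,p)\in[0,\infty]$ be its expected lifetime output. **Theorem 1.** The value function $v^*$ exists and is unique, and there is exactly one price $p^*>0$ with $\int v^*(\phi,p^*)\,\gamma(d\phi)=c_e$. A stationary recursive equilibrium exists if and only if $\ell(p^*)<\infty$. If it exists, it is unique, its price is $p^*$, its mass of entrants $M^*$ is strictly positive, and its productivity measure satisfies $$\mu^*(B)=M^*\cdot\mathbb E\sum_{t=1}^{\tau(p^*)}\mathbb 1\{\phi_t\in B\}\quad\text{for all Borel sets }B\subseteq\mathbb R_+ .$$ -/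

import Mathlib

open MeasureTheory ProbabilityTheory Filter Topology
open scoped NNReal ENNReal

noncomputable section

/-- The primitives of an entry-exit industry. Productivity levels and prices live in `ℝ₊ = ℝ≥0`. -/
structure Industry where
  /-- demand `D(p)`, possibly infinite -/
  demand : ℝ≥0 → ℝ≥0∞
  /-- profit `π(φ, p)` -/
  profit : ℝ≥0 → ℝ≥0 → ℝ
  /-- (nonnegative) output `q(φ, p)` -/
  output : ℝ≥0 → ℝ≥0 → ℝ≥0
  /-- the incumbents' productivity transition kernel `Γ` -/
  trans : Kernel ℝ≥0 ℝ≥0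
  /-- the entrants' productivity distribution `γ` -/
  entrant : Measure ℝ≥0
  /-- the fixed cost of entry -/
  entryCost : ℝ
  /-- the interest rate -/
  rate : ℝ
  [markov_trans : IsMarkovKernel trans]
  [prob_entrant : IsProbabilityMeasure entrant]

namespace Industry

attribute [instance] Industry.markov_trans Industry.prob_entrant

variable (E : Industry)

/-- The discount factor `β = 1 / (1 + r)`. -/
def discount : ℝ := 1 / (1 + E.rate)

/-- The constant `b = 1 - π(0, 0)`; since `π` is increasing, `π + b ≥ 1`. -/
def shift : ℝ := 1 - E.profit 0 0

/-- The weight `κ(φ, p) = ∑ₜ δᵗ E_φ [π(φₜ, p) + b]`, where `φₜ` has law `Γᵗ(φ, ·)`. -/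
def weight (δ : ℝ) (φ p : ℝ≥0) : ℝ≥0∞ :=
  ∑' t : ℕ, ENNReal.ofReal (δ ^ t) *
    ∫⁻ x, ENNReal.ofReal (E.profit x p + E.shift) ∂((E.trans ^ t) φ)

/-- The class of continuous, increasing, `κ`-bounded functions on `ℝ₊²`. -/
structure IsAdmissible (δ : ℝ) (u : ℝ≥0 → ℝ≥0 → ℝ) : Prop where
  continuous : Continuous (fun z : ℝ≥0 × ℝ≥0 => u z.1 z.2)
  monotone : Monotone (fun z : ℝ≥0 × ℝ≥0 => u z.1 z.2)
  bounded : ∃ K : ℝ≥0, ∀ φ p, ENNReal.ofReal |u φ p| ≤ K * E.weight δ φ p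

/-- The standing assumptions on an industry, for a rate `δ ∈ (β, 1)`. -/
structure Standing (δ : ℝ) : Prop where
  rate_pos : 0 < E.rate
  entryCost_pos : 0 < E.entryCost
  -- demand
  demand_continuous : Continuous E.demand
  demand_strictAnti : StrictAnti E.demand
  demand_zero : E.demand 0 = ⊤
  demand_tendsto : Tendsto E.demand atTop (𝓝 0)
  -- profit and output
  profit_continuous : Continuous (fun z : ℝ≥0 × ℝ≥0 => E.profit z.1 z.2)
  profit_strictMono : StrictMono (fun z : ℝ≥0 × ℝ≥0 => E.profit z.1 z.2)
  output_continuous : Continuous (fun z : ℝ≥0 × ℝ≥0 => E.output z.1 z.2)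
  output_strictMono : StrictMono (fun z : ℝ≥0 × ℝ≥0 => E.output z.1 z.2)
  profit_neg : ∀ φ p : ℝ≥0, φ = 0 ∨ p = 0 → E.profit φ p < 0
  -- the kernel of incumbents is monotone increasing
  trans_monotone : ∀ a : ℝ≥0, Antitone (fun φ => E.trans φ (Set.Iic a))
  trans_recurrent : ∀ a : ℝ≥0, 0 < a → ∀ φ : ℝ≥0, ∃ n : ℕ, 0 < (E.trans ^ n) φ (Set.Iio a)
  trans_profit : ∀ p : ℝ≥0, 0 < p → ∃ φ : ℝ≥0, 0 ≤ ∫ x, E.profit x p ∂(E.trans φ)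
  -- entrants
  entrant_output : ∀ p : ℝ≥0, ∫⁻ x, (E.output x p : ℝ≥0∞) ∂E.entrant < ⊤
  entrant_low : ∀ a : ℝ≥0, 0 < a → 0 < E.entrant (Set.Iic a)
  entrant_profit : ∃ p : ℝ≥0, 0 < p ∧ E.entryCost ≤ ∫ x, E.profit x p ∂E.entrant
  -- a firm with zero productivity does not expect positive lifetime profits from continuing
  profit_zero : ∀ p : ℝ≥0,
    ∑' t : ℕ, E.discount ^ (t + 1) * ∫ x, E.profit x p ∂((E.trans ^ (t + 1)) 0) ≤ 0
  -- finiteness of expected discounted profits; `φₜ` has law `γ Γᵗ`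
  delta_gt : E.discount < δ
  delta_lt : δ < 1
  profit_integrable : ∀ (p : ℝ≥0) (t : ℕ),
    Integrable (fun x => E.profit x p) (E.entrant.bind ⇑(E.trans ^ t))
  profit_summable : ∀ p : ℝ≥0,
    Summable (fun t : ℕ => δ ^ t * ∫ x, E.profit x p ∂(E.entrant.bind ⇑(E.trans ^ t)))
  weight_finite : ∀ φ p : ℝ≥0, E.weight δ φ p < ⊤
  -- continuity of the kernel on admissible functions
  trans_continuous : ∀ u : ℝ≥0 → ℝ≥0 → ℝ, E.IsAdmissible δ u →
    Continuous (fun z : ℝ≥0 × ℝ≥0 => ∫ x, u x z.2 ∂(E.trans z.1))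

/-- `v` is a solution, in the admissible class, of the incumbents' Bellman equation. -/
structure IsValueFunction (δ : ℝ) (v : ℝ≥0 → ℝ≥0 → ℝ) : Prop where
  admissible : E.IsAdmissible δ v
  bellman : ∀ φ p, v φ p = E.profit φ p + E.discount * max 0 (∫ x, v x p ∂(E.trans φ))

/-- The exit threshold `min {φ | ∫ v(φ', p) Γ(φ, dφ') ≥ 0}`, equal to `∞` if the set is empty. -/
def threshold (v : ℝ≥0 → ℝ≥0 → ℝ) (p : ℝ≥0) : ℝ≥0∞ :=
  sInf ((fun φ : ℝ≥0 => (φ : ℝ≥0∞)) '' {φ | 0 ≤ ∫ x, v x p ∂(E.trans φ)})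

/-- At the price `p`, the expected value of an entrant is equal to the cost of entry. -/
def IsEntryPrice (v : ℝ≥0 → ℝ≥0 → ℝ) (p : ℝ≥0) : Prop :=
  0 < p ∧ ∫ x, v x p ∂E.entrant = E.entryCost

/-- The law, on sequences, of the productivity process of a firm: a Markov chain with
initial distribution `γ` and transition kernel `Γ`. The first date of a firm's life is `t = 1`:
the coordinate `n` of a sequence is the productivity `φₜ` at `t = n + 1`. -/
def pathLaw : Measure (ℕ → ℝ≥0) :=
  Kernel.trajMeasure (X := fun _ : ℕ => ℝ≥0) E.entrant
    (fun n => E.trans.comap (fun h : (i : Finset.Iic n) → ℝ≥0 => h ⟨n, Finset.mem_Iic.2 le_rfl⟩)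
      (measurable_pi_apply _))

/-- The lifespan `τ(p) = inf {t ≥ 1 | φₜ < threshold}` of a firm with productivity path
`φₜ = ω (t - 1)`, equal to `∞` if the firm never exits. -/
def lifespan (v : ℝ≥0 → ℝ≥0 → ℝ) (p : ℝ≥0) (ω : ℕ → ℝ≥0) : ℕ∞ :=
  sInf {t : ℕ∞ | ∃ n : ℕ, t = ((n + 1 : ℕ) : ℕ∞) ∧ (ω n : ℝ≥0∞) < E.threshold v p}

open Classical in
/-- The expectation `E ∑_{t=1}^{τ(p)} f(φₜ)` of a sum over the lifetime of a firm. -/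
def expectedLifetimeSum (v : ℝ≥0 → ℝ≥0 → ℝ) (p : ℝ≥0) (f : ℝ≥0 → ℝ≥0∞) : ℝ≥0∞ :=
  ∫⁻ ω, ∑' n : ℕ, (if ((n + 1 : ℕ) : ℕ∞) ≤ E.lifespan v p ω then f (ω n) else 0) ∂E.pathLaw

/-- Expected lifetime output `ℓ(p)`. -/
def expectedLifetimeOutput (v : ℝ≥0 → ℝ≥0 → ℝ) (p : ℝ≥0) : ℝ≥0∞ :=
  E.expectedLifetimeSum v p (fun x => (E.output x p : ℝ≥0∞))

/-- The triple of a price `p`, a measure of firms `μ` and a mass of entrants `M` is a stationary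
recursive equilibrium, where `v` is the value function. -/
structure IsEquilibrium (v : ℝ≥0 → ℝ≥0 → ℝ) (p : ℝ≥0) (μ : Measure ℝ≥0) (M : ℝ≥0) : Prop where
  price_pos : 0 < p
  finite : IsFiniteMeasure μ
  entry_le : ∫ x, v x p ∂E.entrant ≤ E.entryCost
  entry_eq : 0 < M → ∫ x, v x p ∂E.entrant = E.entryCost
  invariant : ∀ B : Set ℝ≥0, MeasurableSet B →
    μ B = (∫⁻ φ, {φ : ℝ≥0 | E.threshold v p ≤ φ}.indicator (fun φ => E.trans φ B) φ ∂μ)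
      + M * E.entrant B
  balanced : (M : ℝ≥0∞) = μ {φ : ℝ≥0 | (φ : ℝ≥0∞) < E.threshold v p}
  market : ∫⁻ φ, (E.output φ p : ℝ≥0∞) ∂μ = E.demand p

end Industry

end

/-!
The weight satisfies `κ = π + b + δ Γκ`, so `Γ` has norm at most `1 / δ` for the `κ`-weighted
supremum norm, and the Bellman operator is a contraction of modulus `β / δ < 1`
(`Industry.abs_bellman_sub_le`). Since `κ` is increasing, it is locally bounded, and limits in the
weighted norm are locally uniform; hence the iterates of the Bellman operator converge to an
admissible fixed point `v`, and it is the only one.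

The value is strictly increasing in the price and negative at the price zero, and the law of
entrants integrates `κ`; by dominated convergence the expected value of an entrant is continuous
and strictly increasing in the price, and the intermediate value theorem gives the entry price.

At a positive price the exit threshold `a` is finite and positive. For positivity
(`Industry.IsValueFunction.continuation_zero_neg`): if continuing had nonnegative value at
productivity zero, it would have positive value there at any higher price; then no firm would exit
at that price, and the value of continuing would be the discounted sum of the profits from staying
forever, which is assumed nonpositive.

Let `Q` be the kernel `Γ` killed below `a`. Time invariance says `μ = μ Q + M γ`. A finite measure
with `ν = ν Q` loses no mass to killing, so it is `Γ`-invariant and does not charge the exit region,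
which the chain reaches from everywhere: it is zero
(`ProbabilityTheory.Kernel.eq_zero_of_bind_killed_eq`). Therefore `μ = M ∑ₙ γ Qⁿ`, which by the
Markov property is `M` times the expected occupation time before exit
(`Industry.expectedLifetimeSum_eq`). Supply is then `M ℓ(p)`. As demand is positive, `M > 0`, so
that the price is the entry price; as demand there is finite, `ℓ(p)` is finite and `M = D(p) / ℓ(p)`.
Conversely, if `ℓ(p) < ∞` at the entry price, this `M` and the corresponding `μ` are an equilibrium:
`μ` is finite because output is at least `q(0, p) > 0`.
-/

/-! ### Monotone expectations -/

theorem eq_univ_or_Iio_or_Iic {S : Set ℝ≥0} (hS : IsLowerSet S) :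
    S = Set.univ ∨ ∃ a, S = Set.Iio a ∨ S = Set.Iic a := by
  by_cases hb : BddAbove S
  · rcases S.eq_empty_or_nonempty with rfl | hne
    · exact Or.inr ⟨0, Or.inl (by ext; simp)⟩
    · refine Or.inr ⟨sSup S, ?_⟩
      have hlt : ∀ x, x < sSup S → x ∈ S := fun x hx => by
        obtain ⟨y, hy, hxy⟩ := exists_lt_of_lt_csSup hne hx
        exact hS hxy.le hy
      by_cases hmem : sSup S ∈ S
      · exact Or.inr (Set.Subset.antisymm (fun x hx => le_csSup hb hx) fun x hx => hS hx hmem)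
      · exact Or.inl (Set.Subset.antisymm
          (fun x hx => (le_csSup hb hx).lt_of_ne fun h => hmem (h ▸ hx)) hlt)
  · refine Or.inl (Set.eq_univ_of_forall fun x => ?_)
    obtain ⟨y, hy, hxy⟩ := not_bddAbove_iff.1 hb x
    exact hS hxy.le hy

/-- If `ν` dominates `μ` in the sense of distribution functions, then `ν` gives the larger
integral to every increasing function. -/
theorem lintegral_mono_of_cdf_le {μ ν : Measure ℝ≥0} [IsProbabilityMeasure μ]
    [IsProbabilityMeasure ν] (h : ∀ a, ν (Set.Iic a) ≤ μ (Set.Iic a)) {f : ℝ≥0 → ℝ≥0∞}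
    (hf : Monotone f) : ∫⁻ x, f x ∂μ ≤ ∫⁻ x, f x ∂ν := by
  -- Lower sets are rays, so the hypothesis on closed rays bounds them all.
  have lower : ∀ S : Set ℝ≥0, IsLowerSet S → ν S ≤ μ S := by
    intro S hS
    rcases eq_univ_or_Iio_or_Iic hS with rfl | ⟨a, rfl | rfl⟩
    · simp
    · rcases eq_or_ne a 0 with rfl | ha
      · simp
      obtain ⟨u, hu, hua, hlim⟩ := exists_seq_strictMono_tendsto' (pos_iff_ne_zero.2 ha)
      have hU : Set.Iio a = ⋃ n, Set.Iic (u n) := by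
        ext x
        simp only [Set.mem_Iio, Set.mem_iUnion, Set.mem_Iic]
        constructor
        · intro hx
          obtain ⟨n, hn⟩ := (hlim.eventually (lt_mem_nhds hx)).exists
          exact ⟨n, hn.le⟩
        · rintro ⟨n, hn⟩
          exact hn.trans_lt (hua n).2
      have hm : Monotone fun n => Set.Iic (u n) := fun i j hij => Set.Iic_subset_Iic.2 (hu.monotone hij)
      rw [hU, hm.measure_iUnion, hm.measure_iUnion]
      exact iSup_mono fun n => h _
    · exact h a
  have upper : ∀ S : Set ℝ≥0, IsUpperSet S → μ S ≤ ν S := by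
    intro S hS
    have hm : MeasurableSet S := hS.ordConnected.measurableSet
    have h1 := lower Sᶜ hS.compl
    rw [prob_compl_eq_one_sub hm, prob_compl_eq_one_sub hm] at h1
    exact (ENNReal.sub_le_sub_iff_left prob_le_one ENNReal.one_ne_top).1 h1
  -- The superlevel sets of an increasing function are upper sets: apply the layer cake formula.
  have real : ∀ g : ℝ≥0 → ℝ, Monotone g → (∀ x, 0 ≤ g x) →
      ∫⁻ x, ENNReal.ofReal (g x) ∂μ ≤ ∫⁻ x, ENNReal.ofReal (g x) ∂ν := by
    intro g hg h0
    rw [lintegral_eq_lintegral_meas_lt _ (ae_of_all _ h0) hg.measurable.aemeasurable,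
      lintegral_eq_lintegral_meas_lt _ (ae_of_all _ h0) hg.measurable.aemeasurable]
    exact lintegral_mono fun t => upper _ fun x y hxy hx => lt_of_lt_of_le hx (hg hxy)
  -- The layer cake formula is for real functions; truncate to allow the value `∞`.
  have trunc : ∀ x, f x = ⨆ n : ℕ, ENNReal.ofReal ((min (f x) n).toReal) := by
    intro x
    simp_rw [ENNReal.ofReal_toReal (ne_top_of_le_ne_top (ENNReal.natCast_ne_top _) (min_le_right _ _))]
    rw [← inf_iSup_eq, ENNReal.iSup_natCast, inf_top_eq]
  have hmono : ∀ n : ℕ, Monotone fun x => (min (f x) (n : ℝ≥0∞)).toReal := fun n x y hxy =>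
    ENNReal.toReal_mono (ne_top_of_le_ne_top (ENNReal.natCast_ne_top _) (min_le_right _ _))
      (min_le_min_right _ (hf hxy))
  have hmono' : Monotone fun (n : ℕ) x => ENNReal.ofReal ((min (f x) (n : ℝ≥0∞)).toReal) :=
    fun m n hmn x => ENNReal.ofReal_le_ofReal <|
      ENNReal.toReal_mono (ne_top_of_le_ne_top (ENNReal.natCast_ne_top _) (min_le_right _ _))
        (min_le_min_left _ (by exact_mod_cast hmn))
  rw [lintegral_congr trunc, lintegral_congr (μ := ν) trunc,
    lintegral_iSup (fun n => (hmono n).measurable.ennreal_ofReal) hmono',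
    lintegral_iSup (fun n => (hmono n).measurable.ennreal_ofReal) hmono']
  exact iSup_mono fun n => real _ (hmono n) fun x => ENNReal.toReal_nonneg

theorem integral_mono_of_cdf_le {μ ν : Measure ℝ≥0} [IsProbabilityMeasure μ]
    [IsProbabilityMeasure ν] (h : ∀ a, ν (Set.Iic a) ≤ μ (Set.Iic a)) {f : ℝ≥0 → ℝ}
    (hf : Monotone f) (hμ : Integrable f μ) (hν : Integrable f ν) :
    ∫ x, f x ∂μ ≤ ∫ x, f x ∂ν := by
  have key : ∀ ρ : Measure ℝ≥0, IsProbabilityMeasure ρ → Integrable f ρ →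
      ENNReal.ofReal (∫ x, f x ∂ρ - f 0) = ∫⁻ x, ENNReal.ofReal (f x - f 0) ∂ρ := by
    intro ρ _ hρ
    rw [← ofReal_integral_eq_lintegral_ofReal (f := fun x => f x - f 0) (hρ.sub (integrable_const _))
      (ae_of_all _ fun x => sub_nonneg.2 (hf (zero_le (a := x)))), integral_sub hρ (integrable_const _)]
    simp
  have h0 : ∀ ρ : Measure ℝ≥0, IsProbabilityMeasure ρ → Integrable f ρ →
      0 ≤ ∫ x, f x ∂ρ - f 0 := by
    intro ρ _ hρ
    have := integral_mono (integrable_const (f 0)) hρ fun x => hf (zero_le (a := x))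
    simpa using this
  have := lintegral_mono_of_cdf_le h (f := fun x => ENNReal.ofReal (f x - f 0))
    fun x y hxy => ENNReal.ofReal_le_ofReal (sub_le_sub_right (hf hxy) _)
  rw [← key μ ‹_› hμ, ← key ν ‹_› hν, ENNReal.ofReal_le_ofReal_iff (h0 ν ‹_› hν)] at this
  linarith

namespace ProbabilityTheory.Kernel

variable {X : Type*} [MeasurableSpace X]

/-! ### Iterated kernels -/

instance isMarkovKernel_pow (κ : Kernel X X) [IsMarkovKernel κ] (n : ℕ) :
    IsMarkovKernel (κ ^ n) := by
  induction n with
  | zero => rw [pow_zero]; exact inferInstanceAs (IsMarkovKernel Kernel.id)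
  | succ n ih => rw [pow_succ]; exact inferInstanceAs (IsMarkovKernel ((κ ^ n) ∘ₖ κ))

theorem lintegral_pow_succ (κ : Kernel X X) (n : ℕ) (a : X) {f : X → ℝ≥0∞} (hf : Measurable f) :
    ∫⁻ x, f x ∂(κ ^ (n + 1)) a = ∫⁻ y, ∫⁻ x, f x ∂(κ ^ n) y ∂κ a := by
  rw [pow_succ]; exact Kernel.lintegral_comp (κ ^ n) κ a hf

theorem lintegral_pow_succ' (κ : Kernel X X) (n : ℕ) (a : X) {f : X → ℝ≥0∞} (hf : Measurable f) :
    ∫⁻ x, f x ∂(κ ^ (n + 1)) a = ∫⁻ y, ∫⁻ x, f x ∂κ y ∂(κ ^ n) a := by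
  rw [pow_succ']; exact Kernel.lintegral_comp κ (κ ^ n) a hf

theorem lintegral_pow_zero (κ : Kernel X X) (a : X) {f : X → ℝ≥0∞} (hf : Measurable f) :
    ∫⁻ x, f x ∂(κ ^ 0) a = f a := by
  rw [pow_zero]; exact lintegral_dirac' a hf

/-- Iterates of a monotone increasing kernel map increasing functions to increasing functions. -/
theorem monotone_lintegral_pow {κ : Kernel ℝ≥0 ℝ≥0} [IsMarkovKernel κ]
    (hκ : ∀ a, Antitone fun φ => κ φ (Set.Iic a)) {f : ℝ≥0 → ℝ≥0∞} (hf : Monotone f) (n : ℕ) :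
    Monotone fun φ => ∫⁻ x, f x ∂(κ ^ n) φ := by
  induction n with
  | zero => simpa only [lintegral_pow_zero κ _ hf.measurable] using hf
  | succ n ih =>
    simp only [lintegral_pow_succ κ n _ hf.measurable]
    exact fun φ φ' h => lintegral_mono_of_cdf_le (fun a => hκ a h) ih

/-! ### Killed kernels and occupation measures -/

/-- The sub-Markov kernel obtained from `κ` by killing the chain when it is outside `A`. -/
noncomputable def killed {A : Set X} (hA : MeasurableSet A) [DecidablePred (· ∈ A)]
    (κ : Kernel X X) : Kernel X X :=
  Kernel.piecewise hA κ 0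

section killed

variable {A : Set X} (hA : MeasurableSet A) [DecidablePred (· ∈ A)] (κ : Kernel X X)

theorem lintegral_killed (a : X) (f : X → ℝ≥0∞) :
    ∫⁻ x, f x ∂κ.killed hA a = A.indicator (fun a => ∫⁻ x, f x ∂κ a) a := by
  by_cases h : a ∈ A <;> simp [killed, Kernel.piecewise_apply, h]

theorem killed_comp_apply (μ : Measure X) {B : Set X} (hB : MeasurableSet B) :
    (μ.bind (κ.killed hA)) B = ∫⁻ x, A.indicator (fun x => κ x B) x ∂μ := by
  rw [Measure.bind_apply hB (Kernel.aemeasurable _)]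
  refine lintegral_congr fun x => ?_
  by_cases h : x ∈ A <;> simp [killed, Kernel.piecewise_apply, h]

/-- The occupation measure `∑ₙ γ Qⁿ` of the chain with initial law `γ` and sub-Markov kernel
`Q`. -/
noncomputable def occupation (γ : Measure X) (Q : Kernel X X) : Measure X :=
  Measure.sum fun n : ℕ => γ.bind ⇑(Q ^ n)

theorem bind_pow_zero (γ : Measure X) (Q : Kernel X X) : γ.bind ⇑(Q ^ 0) = γ := by
  rw [pow_zero]; exact Measure.id_comp

theorem bind_pow_succ (γ : Measure X) (Q : Kernel X X) (n : ℕ) :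
    γ.bind ⇑(Q ^ (n + 1)) = (γ.bind ⇑(Q ^ n)).bind Q := by
  rw [pow_succ']; exact Measure.comp_assoc.symm

/-- The occupation measure solves `G = G Q + γ`. -/
theorem occupation_eq (γ : Measure X) (Q : Kernel X X) :
    occupation γ Q = (occupation γ Q).bind Q + γ := by
  ext B hB
  rw [Measure.add_apply, Measure.bind_apply hB (Kernel.aemeasurable _), occupation,
    Measure.sum_apply _ hB, lintegral_sum_measure, tsum_eq_zero_add' ENNReal.summable,
    bind_pow_zero, add_comm]
  congr 1
  refine tsum_congr fun n => ?_
  rw [bind_pow_succ, Measure.bind_apply hB (Kernel.aemeasurable _)]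

theorem le_occupation (γ : Measure X) (Q : Kernel X X) : γ ≤ occupation γ Q := by
  rw [occupation_eq γ Q]; exact Measure.le_add_left le_rfl

/-- A finite measure that is invariant under the killed kernel vanishes, if the chain reaches the
complement of `A` from every state: no mass is lost to killing, so the measure does not charge
`Aᶜ` and is invariant under `κ` itself, which eventually moves mass into `Aᶜ`. -/
theorem eq_zero_of_bind_killed_eq [IsMarkovKernel κ] (hit : ∀ a, ∃ n : ℕ, 0 < (κ ^ n) a Aᶜ)
    (ν : Measure X) [IsFiniteMeasure ν] (hν : ν.bind (κ.killed hA) = ν) : ν = 0 := by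
  have hmass : ν A = ν Set.univ := by
    conv_rhs => rw [← hν, killed_comp_apply hA κ ν MeasurableSet.univ]
    simp [lintegral_indicator hA]
  have hcompl : ν Aᶜ = 0 := by
    rw [measure_compl hA (measure_ne_top _ _), hmass, tsub_self]
  have hinv : ν.bind κ = ν := by
    conv_rhs => rw [← hν]
    ext B hB
    rw [killed_comp_apply hA κ ν hB, Measure.bind_apply hB (Kernel.aemeasurable _)]
    refine lintegral_congr_ae ?_
    filter_upwards [measure_eq_zero_iff_ae_notMem.1 hcompl] with x hx
    rw [Set.indicator_of_mem (by simpa using hx)]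
  have hpow : ∀ n : ℕ, ν.bind ⇑(κ ^ n) = ν := by
    intro n
    induction n with
    | zero => exact bind_pow_zero ν κ
    | succ n ih => rw [bind_pow_succ, ih, hinv]
  have hae : ∀ᵐ x ∂ν, ∀ n : ℕ, (κ ^ n) x Aᶜ = 0 := by
    refine ae_all_iff.2 fun n => ?_
    have h := hcompl
    rw [← hpow n, Measure.bind_apply hA.compl (Kernel.aemeasurable _),
      lintegral_eq_zero_iff (Kernel.measurable_coe _ hA.compl)] at h
    exact h
  have : ∀ᵐ x ∂ν, False := by
    filter_upwards [hae] with x hx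
    obtain ⟨n, hn⟩ := hit x
    exact hn.ne' (hx n)
  simpa using this

/-- A finite measure that solves `μ = μ Q + γ` for the killed kernel `Q` is the occupation
measure of the killed chain. -/
theorem eq_occupation_of_eq_bind_killed_add [IsMarkovKernel κ]
    (hit : ∀ a, ∃ n : ℕ, 0 < (κ ^ n) a Aᶜ) (γ μ : Measure X) [IsFiniteMeasure μ]
    (hμ : μ = μ.bind (κ.killed hA) + γ) : μ = occupation γ (κ.killed hA) := by
  set Q := κ.killed hA with hQ
  -- Iterating the equation bounds the partial sums of the occupation measure by `μ`; the remainder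
  -- `μ - ∑ₙ γ Qⁿ` is then invariant under the killed kernel.
  have hpart : ∀ n : ℕ, μ = μ.bind ⇑(Q ^ n) + ∑ k ∈ Finset.range n, γ.bind ⇑(Q ^ k) := by
    intro n
    induction n with
    | zero => rw [bind_pow_zero, Finset.sum_range_zero, add_zero]
    | succ n ih =>
      have : μ.bind ⇑(Q ^ n) = μ.bind ⇑(Q ^ (n + 1)) + γ.bind ⇑(Q ^ n) := by
        conv_lhs => rw [hμ]
        rw [Measure.comp_add, pow_succ]
        congr 1
        exact Measure.comp_assoc
      conv_lhs => rw [ih, this]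
      rw [Finset.sum_range_succ, add_assoc, add_comm (γ.bind ⇑(Q ^ n))]
  have hle : occupation γ Q ≤ μ := by
    refine Measure.le_iff.2 fun B hB => ?_
    rw [occupation, Measure.sum_apply _ hB]
    refine ENNReal.tsum_le_of_sum_range_le fun n => ?_
    conv_rhs => rw [hpart n]
    simp
  have : IsFiniteMeasure (occupation γ Q) := isFiniteMeasure_of_le μ hle
  have hsub : μ - occupation γ Q + occupation γ Q = μ := Measure.sub_add_cancel_of_le hle
  have hzero : μ - occupation γ Q = 0 := by
    refine eq_zero_of_bind_killed_eq hA κ hit _ ?_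
    have h1 : (μ - occupation γ Q).bind Q + occupation γ Q = μ - occupation γ Q + occupation γ Q := by
      rw [hsub]
      conv_rhs => rw [hμ, ← hsub, Measure.comp_add, add_assoc, ← occupation_eq γ Q]
    ext B hB
    have h2 := congrArg (fun m : Measure X => m B) h1
    simp only [Measure.add_apply] at h2
    exact (ENNReal.add_left_inj (measure_ne_top _ _)).1 h2
  rw [← hsub, hzero, zero_add]

end killed

end ProbabilityTheory.Kernel

namespace Industry

/-! ### The productivity process of a firm -/

variable (E : Industry)

theorem lintegral_pathLaw_zero {f : ℝ≥0 → ℝ≥0∞} (hf : Measurable f) :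
    ∫⁻ ω, f (ω 0) ∂E.pathLaw = ∫⁻ x, f x ∂E.entrant := by
  have h : E.pathLaw.map (fun ω => ω 0) = E.entrant := by
    have h1 : (fun ω : ℕ → ℝ≥0 => ω 0) =
        (fun h : (i : Finset.Iic 0) → ℝ≥0 => h ⟨0, Finset.mem_Iic.2 le_rfl⟩) ∘
          Preorder.frestrictLe (π := fun _ : ℕ => ℝ≥0) 0 := rfl
    rw [h1, ← Measure.map_map (by fun_prop) (by fun_prop), pathLaw, Kernel.trajMeasure,
      Measure.map_comp _ _ (by fun_prop), Kernel.traj_map_frestrictLe, Kernel.partialTraj_self,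
      Measure.id_comp, Measure.map_map (by fun_prop) (by fun_prop)]
    exact Measure.map_id
  rw [← h, lintegral_map hf (by fun_prop)]

/-- The Markov property of the productivity process. -/
theorem lintegral_pathLaw_succ (n : ℕ) {g : ((i : Finset.Iic n) → ℝ≥0) → ℝ≥0∞}
    (hg : Measurable g) {f : ℝ≥0 → ℝ≥0∞} (hf : Measurable f) :
    ∫⁻ ω, g (Preorder.frestrictLe (π := fun _ : ℕ => ℝ≥0) n ω) * f (ω (n + 1)) ∂E.pathLaw =
      ∫⁻ ω, g (Preorder.frestrictLe (π := fun _ : ℕ => ℝ≥0) n ω) * ∫⁻ x, f x ∂E.trans (ω n)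
        ∂E.pathLaw := by
  have hgf : Measurable fun z : ((i : Finset.Iic n) → ℝ≥0) × ℝ≥0 => g z.1 * f z.2 := by fun_prop
  have hG : Measurable fun y : (i : Finset.Iic n) → ℝ≥0 =>
      g y * ∫⁻ x, f x ∂E.trans (y ⟨n, Finset.mem_Iic.2 le_rfl⟩) :=
    hg.mul (hf.lintegral_kernel.comp (measurable_pi_apply _))
  have h := Kernel.map_frestrictLe_trajMeasure_compProd_eq_map_trajMeasure
    (X := fun _ : ℕ => ℝ≥0) (μ₀ := E.entrant)
    (κ := fun n => E.trans.comap (fun h : (i : Finset.Iic n) → ℝ≥0 => h ⟨n, Finset.mem_Iic.2 le_rfl⟩)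
      (measurable_pi_apply _)) (a := n)
  calc _ = ∫⁻ z, g z.1 * f z.2 ∂(E.pathLaw.map fun ω =>
        (Preorder.frestrictLe (π := fun _ : ℕ => ℝ≥0) n ω, ω (n + 1))) := by
        rw [lintegral_map hgf (by fun_prop)]
    _ = _ := by
        rw [pathLaw, ← h, Measure.lintegral_compProd hgf]
        simp only [Kernel.comap_apply]
        simp_rw [lintegral_const_mul _ hf]
        rw [lintegral_map hG (by fun_prop)]
        rfl

/-- The expectation of `f` at date `n`, on the event that the chain has stayed in `A` so far, is
the integral of `f` against the `n`-th iterate of the killed kernel. -/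
theorem lintegral_pathLaw_indicator {A : Set ℝ≥0} (hA : MeasurableSet A)
    [DecidablePred (· ∈ A)] (n : ℕ) {f : ℝ≥0 → ℝ≥0∞} (hf : Measurable f) :
    ∫⁻ ω, {ω : ℕ → ℝ≥0 | ∀ m < n, ω m ∈ A}.indicator (fun ω => f (ω n)) ω ∂E.pathLaw =
      ∫⁻ x, f x ∂(E.entrant.bind ⇑(E.trans.killed hA ^ n)) := by
  induction n generalizing f with
  | zero => rw [Kernel.bind_pow_zero, ← E.lintegral_pathLaw_zero hf]; simp
  | succ n ih =>
    -- Survival up to date `n` is an event in the first `n + 1` coordinates; the Markov property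
    -- replaces `f` at date `n + 1` by its conditional expectation at date `n`.
    set G : Set ((i : Finset.Iic n) → ℝ≥0) := Set.univ.pi fun _ => A with hGdef
    have hG : MeasurableSet G := MeasurableSet.univ_pi fun _ => hA
    have hmem : ∀ ω : ℕ → ℝ≥0, Preorder.frestrictLe (π := fun _ : ℕ => ℝ≥0) n ω ∈ G ↔
        ∀ m < n + 1, ω m ∈ A := by
      intro ω
      simp only [hGdef, Set.mem_univ_pi, Subtype.forall, Finset.mem_Iic, Nat.lt_succ_iff]
      rfl
    have hQf : Measurable fun y => ∫⁻ x, f x ∂E.trans.killed hA y := hf.lintegral_kernel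
    rw [Kernel.bind_pow_succ, Measure.lintegral_bind (Kernel.aemeasurable _) hf.aemeasurable,
      ← ih hQf]
    have h := E.lintegral_pathLaw_succ n (measurable_one.indicator hG) hf
    refine Eq.trans ?_ (h.trans ?_)
    · refine lintegral_congr fun ω => ?_
      by_cases hω : ∀ m < n + 1, ω m ∈ A
      · rw [Set.indicator_of_mem (by exact hω), Set.indicator_of_mem ((hmem ω).2 hω)]; simp
      · rw [Set.indicator_of_notMem (by exact hω),
          Set.indicator_of_notMem (mt (hmem ω).1 hω), zero_mul]
    · refine lintegral_congr fun ω => ?_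
      simp only [Kernel.lintegral_killed]
      by_cases hω : ∀ m < n + 1, ω m ∈ A
      · rw [Set.indicator_of_mem ((hmem ω).2 hω),
          Set.indicator_of_mem (by exact fun m hm => hω m (hm.trans n.lt_succ_self)),
          Set.indicator_of_mem (hω n n.lt_succ_self)]
        simp
      · rw [Set.indicator_of_notMem (mt (hmem ω).1 hω), zero_mul]
        by_cases hω' : ∀ m < n, ω m ∈ A
        · have : ω n ∉ A := fun hn => hω fun m hm =>
            (Nat.lt_succ_iff_lt_or_eq.1 hm).elim (hω' m) fun h => h ▸ hn
          rw [Set.indicator_of_mem (by exact hω'), Set.indicator_of_notMem this]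
        · rw [Set.indicator_of_notMem (by exact hω')]

/-- A firm is alive at date `n + 1` if it has not met the exit criterion at dates `1, …, n`. -/
theorem le_lifespan_iff (v : ℝ≥0 → ℝ≥0 → ℝ) (p : ℝ≥0) (ω : ℕ → ℝ≥0) (n : ℕ) :
    ((n + 1 : ℕ) : ℕ∞) ≤ E.lifespan v p ω ↔ ∀ m < n, E.threshold v p ≤ ω m := by
  rw [lifespan, le_sInf_iff]
  constructor
  · intro h m hm
    by_contra! hlt
    have := h _ ⟨m, rfl, hlt⟩
    rw [Nat.cast_le] at this
    omega
  · rintro h _ ⟨m, rfl, hlt⟩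
    rw [Nat.cast_le]
    by_contra! hm
    exact (h m (by omega)).not_gt hlt

/-- Sums over the lifetime of a firm are integrals against the occupation measure of the chain
killed upon exit. -/
theorem expectedLifetimeSum_eq (v : ℝ≥0 → ℝ≥0 → ℝ) (p : ℝ≥0) {A : Set ℝ≥0}
    (hA : MeasurableSet A) [DecidablePred (· ∈ A)]
    (hAv : ∀ φ : ℝ≥0, φ ∈ A ↔ E.threshold v p ≤ φ) {f : ℝ≥0 → ℝ≥0∞} (hf : Measurable f) :
    E.expectedLifetimeSum v p f =
      ∫⁻ x, f x ∂(Kernel.occupation E.entrant (E.trans.killed hA)) := by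
  have hind : ∀ (n : ℕ) (ω : ℕ → ℝ≥0),
      {ω : ℕ → ℝ≥0 | ∀ m < n, ω m ∈ A}.indicator (fun ω => f (ω n)) ω =
        if ((n + 1 : ℕ) : ℕ∞) ≤ E.lifespan v p ω then f (ω n) else 0 := by
    intro n ω
    simp only [E.le_lifespan_iff, ← hAv, Set.indicator_apply, Set.mem_ofPred_eq]
  have hm : ∀ n : ℕ, MeasurableSet {ω : ℕ → ℝ≥0 | ∀ m < n, ω m ∈ A} := by
    intro n
    simp only [Set.ofPred_forall]
    exact MeasurableSet.iInter fun m => MeasurableSet.iInter fun _ => measurable_pi_apply m hA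
  rw [expectedLifetimeSum, Kernel.occupation, lintegral_sum_measure]
  simp only [← hind]
  have hmeas : ∀ n : ℕ, Measurable fun ω : ℕ → ℝ≥0 =>
      {ω : ℕ → ℝ≥0 | ∀ m < n, ω m ∈ A}.indicator (fun ω => f (ω n)) ω :=
    fun n => (hf.comp (measurable_pi_apply n)).indicator (hm n)
  rw [lintegral_tsum fun n => (hmeas n).aemeasurable]
  exact tsum_congr fun n => E.lintegral_pathLaw_indicator hA n hf

variable {E} {δ : ℝ}

/-! ### The weight function -/

namespace Standing

theorem discount_pos (hE : E.Standing δ) : 0 < E.discount :=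
  one_div_pos.2 (add_pos one_pos hE.rate_pos)

theorem delta_pos (hE : E.Standing δ) : 0 < δ := hE.discount_pos.trans hE.delta_gt

theorem ratio_nonneg (hE : E.Standing δ) : 0 ≤ E.discount / δ :=
  (div_pos hE.discount_pos hE.delta_pos).le

theorem ratio_lt_one (hE : E.Standing δ) : E.discount / δ < 1 :=
  (div_lt_one hE.delta_pos).2 hE.delta_gt

theorem one_le_profit_add_shift (hE : E.Standing δ) (φ p : ℝ≥0) : 1 ≤ E.profit φ p + E.shift := by
  have h : E.profit 0 0 ≤ E.profit φ p :=
    hE.profit_strictMono.monotone (a := (0, 0)) (b := (φ, p)) ⟨zero_le, zero_le⟩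
  unfold shift; linarith

theorem measurable_profit (hE : E.Standing δ) (p : ℝ≥0) : Measurable fun φ => E.profit φ p :=
  (hE.profit_continuous.comp (by fun_prop : Continuous fun φ : ℝ≥0 => (φ, p))).measurable

theorem measurable_profit_add_shift (hE : E.Standing δ) (p : ℝ≥0) :
    Measurable fun φ => ENNReal.ofReal (E.profit φ p + E.shift) :=
  ((hE.measurable_profit p).add_const _).ennreal_ofReal

theorem measurable_weight (hE : E.Standing δ) (p : ℝ≥0) : Measurable fun φ => E.weight δ φ p :=
  Measurable.tsum fun _ =>
    ((hE.measurable_profit_add_shift p).lintegral_kernel).const_mul _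

/-- The recursion `κ = π + b + δ Γκ`. -/
theorem weight_eq_add (hE : E.Standing δ) (φ p : ℝ≥0) :
    E.weight δ φ p = ENNReal.ofReal (E.profit φ p + E.shift) +
      ENNReal.ofReal δ * ∫⁻ x, E.weight δ x p ∂E.trans φ := by
  have hm := hE.measurable_profit_add_shift p
  conv_lhs => rw [weight, tsum_eq_zero_add' ENNReal.summable]
  rw [Kernel.lintegral_pow_zero _ _ hm, pow_zero, ENNReal.ofReal_one, one_mul]
  congr 1
  simp only [weight]
  rw [lintegral_tsum fun t => (hm.lintegral_kernel.const_mul _).aemeasurable,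
    ← ENNReal.tsum_mul_left]
  refine tsum_congr fun t => ?_
  rw [Kernel.lintegral_pow_succ _ _ _ hm, lintegral_const_mul _ hm.lintegral_kernel, pow_succ',
    ENNReal.ofReal_mul hE.delta_pos.le, mul_assoc]

theorem weight_mono (hE : E.Standing δ) {φ φ' p p' : ℝ≥0} (hφ : φ ≤ φ') (hp : p ≤ p') :
    E.weight δ φ p ≤ E.weight δ φ' p' := by
  have hmono : ∀ {x x' q q' : ℝ≥0}, x ≤ x' → q ≤ q' →
      ENNReal.ofReal (E.profit x q + E.shift) ≤ ENNReal.ofReal (E.profit x' q' + E.shift) :=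
    fun {x x' q q'} hx hq => ENNReal.ofReal_le_ofReal <| add_le_add_left
      (hE.profit_strictMono.monotone (a := (x, q)) (b := (x', q')) ⟨hx, hq⟩) _
  refine ENNReal.tsum_le_tsum fun t => mul_le_mul_right ?_ _
  exact (lintegral_mono fun x => hmono le_rfl hp).trans
    (Kernel.monotone_lintegral_pow hE.trans_monotone (fun x x' hx => hmono hx le_rfl) t hφ)

/-- The weight is excessive: `δⁿ Γⁿκ ≤ κ`, so that `Γ` has norm at most `1 / δ` for the weighted
supremum norm. -/
theorem lintegral_weight_pow_le (hE : E.Standing δ) (n : ℕ) (φ p : ℝ≥0) :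
    ENNReal.ofReal (δ ^ n) * ∫⁻ x, E.weight δ x p ∂(E.trans ^ n) φ ≤ E.weight δ φ p := by
  have hm := hE.measurable_weight p
  induction n with
  | zero => rw [Kernel.lintegral_pow_zero _ _ hm, pow_zero, ENNReal.ofReal_one, one_mul]
  | succ n ih =>
    refine le_trans ?_ ih
    rw [Kernel.lintegral_pow_succ' _ _ _ hm, pow_succ, ENNReal.ofReal_mul (pow_nonneg hE.delta_pos.le n),
      mul_assoc, ← lintegral_const_mul _ hm.lintegral_kernel]
    gcongr with x
    rw [hE.weight_eq_add x p]
    exact le_add_self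

theorem lintegral_weight_pow_lt_top (hE : E.Standing δ) (n : ℕ) (φ p : ℝ≥0) :
    ∫⁻ x, E.weight δ x p ∂(E.trans ^ n) φ < ⊤ := by
  by_contra! h
  have h1 := hE.lintegral_weight_pow_le n φ p
  rw [top_le_iff.1 h, ENNReal.mul_top (by simpa using pow_pos hE.delta_pos n)] at h1
  exact (hE.weight_finite φ p).not_ge h1

theorem lintegral_weight_trans_lt_top (hE : E.Standing δ) (φ p : ℝ≥0) :
    ∫⁻ x, E.weight δ x p ∂E.trans φ < ⊤ := by
  simpa using hE.lintegral_weight_pow_lt_top 1 φ p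

theorem integrable_weight (hE : E.Standing δ) {p : ℝ≥0} {μ : Measure ℝ≥0}
    (hμ : ∫⁻ x, E.weight δ x p ∂μ < ⊤) : Integrable (fun x => (E.weight δ x p).toReal) μ :=
  integrable_toReal_of_lintegral_ne_top (hE.measurable_weight p).aemeasurable hμ.ne

theorem integral_weight_pow_le (hE : E.Standing δ) (n : ℕ) (φ p : ℝ≥0) :
    δ ^ n * ∫ x, (E.weight δ x p).toReal ∂(E.trans ^ n) φ ≤ (E.weight δ φ p).toReal := by
  rw [integral_toReal (hE.measurable_weight p).aemeasurable (ae_of_all _ fun x => hE.weight_finite x p)]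
  have := ENNReal.toReal_mono (hE.weight_finite φ p).ne (hE.lintegral_weight_pow_le n φ p)
  rwa [ENNReal.toReal_mul, ENNReal.toReal_ofReal (pow_nonneg hE.delta_pos.le n)] at this

theorem integral_weight_trans_le (hE : E.Standing δ) (φ p : ℝ≥0) :
    ∫ x, (E.weight δ x p).toReal ∂E.trans φ ≤ (E.weight δ φ p).toReal / δ := by
  rw [le_div_iff₀' hE.delta_pos]
  simpa using hE.integral_weight_pow_le 1 φ p

theorem profit_add_shift_le_weight (hE : E.Standing δ) (φ p : ℝ≥0) :
    E.profit φ p + E.shift ≤ (E.weight δ φ p).toReal := by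
  refine (ENNReal.ofReal_le_iff_le_toReal (hE.weight_finite φ p).ne).1 ?_
  rw [hE.weight_eq_add φ p]
  exact le_self_add

theorem one_le_weight (hE : E.Standing δ) (φ p : ℝ≥0) : 1 ≤ (E.weight δ φ p).toReal :=
  (hE.one_le_profit_add_shift φ p).trans (hE.profit_add_shift_le_weight φ p)

theorem abs_profit_le (hE : E.Standing δ) (φ p : ℝ≥0) :
    |E.profit φ p| ≤ (1 + |E.shift|) * (E.weight δ φ p).toReal := by
  have h1 := hE.profit_add_shift_le_weight φ p
  have h2 := hE.one_le_profit_add_shift φ p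
  have h3 := hE.one_le_weight φ p
  have h4 : |E.shift| ≤ |E.shift| * (E.weight δ φ p).toReal :=
    le_mul_of_one_le_right (abs_nonneg _) h3
  have := neg_abs_le E.shift
  have := le_abs_self E.shift
  rw [abs_le]
  constructor <;> linarith

/-- The law of an entrant integrates the weight, by the finiteness of expected discounted profits
of entrants. -/
theorem lintegral_weight_entrant_lt_top (hE : E.Standing δ) (p : ℝ≥0) :
    ∫⁻ x, E.weight δ x p ∂E.entrant < ⊤ := by
  have hm := hE.measurable_profit_add_shift p
  have hterm : ∀ t : ℕ, ENNReal.ofReal (δ ^ t) *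
      ∫⁻ φ, ∫⁻ x, ENNReal.ofReal (E.profit x p + E.shift) ∂(E.trans ^ t) φ ∂E.entrant =
      ENNReal.ofReal (δ ^ t * ∫ x, E.profit x p ∂(E.entrant.bind ⇑(E.trans ^ t)) + E.shift * δ ^ t) := by
    intro t
    have hint := hE.profit_integrable p t
    have hδ := pow_nonneg hE.delta_pos.le t
    rw [← Measure.lintegral_bind (Kernel.aemeasurable _) hm.aemeasurable,
      ← ofReal_integral_eq_lintegral_ofReal (f := fun x => E.profit x p + E.shift)
        (hint.add (integrable_const _))
        (ae_of_all _ fun x => zero_le_one.trans (hE.one_le_profit_add_shift x p)),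
      ← ENNReal.ofReal_mul hδ]
    rw [integral_add hint (integrable_const E.shift), integral_const, probReal_univ, one_smul,
      mul_add, mul_comm E.shift]
  simp only [weight]
  rw [lintegral_tsum fun t => (hm.lintegral_kernel.const_mul _).aemeasurable]
  simp_rw [lintegral_const_mul _ hm.lintegral_kernel, hterm]
  have hs : Summable fun t : ℕ =>
      δ ^ t * ∫ x, E.profit x p ∂(E.entrant.bind ⇑(E.trans ^ t)) + E.shift * δ ^ t :=
    (hE.profit_summable p).add
      ((summable_geometric_of_lt_one hE.delta_pos.le hE.delta_lt).mul_left _)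
  exact hs.tsum_ofReal_lt_top

end Standing

/-! ### Admissible functions and the Bellman operator -/

namespace IsAdmissible

variable {u : ℝ≥0 → ℝ≥0 → ℝ}

theorem exists_abs_le (hE : E.Standing δ) (hu : E.IsAdmissible δ u) :
    ∃ K : ℝ, 0 ≤ K ∧ ∀ φ p, |u φ p| ≤ K * (E.weight δ φ p).toReal := by
  obtain ⟨K, hK⟩ := hu.bounded
  refine ⟨K, K.2, fun φ p => ?_⟩
  have hfin := (hE.weight_finite φ p).ne
  have := (ENNReal.ofReal_le_iff_le_toReal (ENNReal.mul_ne_top ENNReal.coe_ne_top hfin)).1 (hK φ p)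
  simpa using this

theorem of_abs_le (hE : E.Standing δ)
    (hc : Continuous (fun z : ℝ≥0 × ℝ≥0 => u z.1 z.2))
    (hm : Monotone (fun z : ℝ≥0 × ℝ≥0 => u z.1 z.2)) {K : ℝ}
    (hK : ∀ φ p, |u φ p| ≤ K * (E.weight δ φ p).toReal) : E.IsAdmissible δ u := by
  refine ⟨hc, hm, K.toNNReal, fun φ p => ?_⟩
  have hfin := (hE.weight_finite φ p).ne
  refine (ENNReal.ofReal_le_iff_le_toReal (ENNReal.mul_ne_top ENNReal.coe_ne_top hfin)).2 ?_
  rw [ENNReal.toReal_mul, ENNReal.coe_toReal]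
  exact (hK φ p).trans (mul_le_mul_of_nonneg_right (Real.le_coe_toNNReal K) ENNReal.toReal_nonneg)

theorem continuous_left (hu : E.IsAdmissible δ u) (p : ℝ≥0) : Continuous fun φ => u φ p :=
  hu.continuous.comp (by fun_prop : Continuous fun φ : ℝ≥0 => (φ, p))

theorem mono (hu : E.IsAdmissible δ u) {φ φ' p p' : ℝ≥0} (hφ : φ ≤ φ') (hp : p ≤ p') :
    u φ p ≤ u φ' p' :=
  hu.monotone (a := (φ, p)) (b := (φ', p')) ⟨hφ, hp⟩

theorem integrable (hE : E.Standing δ) (hu : E.IsAdmissible δ u) {p : ℝ≥0} {μ : Measure ℝ≥0}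
    (hμ : ∫⁻ x, E.weight δ x p ∂μ < ⊤) : Integrable (fun x => u x p) μ := by
  obtain ⟨K, -, hK⟩ := hu.exists_abs_le hE
  exact ((hE.integrable_weight hμ).const_mul K).mono'
    (hu.continuous_left p).measurable.aestronglyMeasurable (ae_of_all _ fun x => hK x p)

theorem integrable_trans (hE : E.Standing δ) (hu : E.IsAdmissible δ u) (φ p : ℝ≥0) :
    Integrable (fun x => u x p) (E.trans φ) :=
  hu.integrable hE (hE.lintegral_weight_trans_lt_top φ p)

/-- The expected value of continuing is increasing in productivity and in the price. -/
theorem integral_trans_mono (hE : E.Standing δ) (hu : E.IsAdmissible δ u) {φ φ' p p' : ℝ≥0}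
    (hφ : φ ≤ φ') (hp : p ≤ p') : ∫ x, u x p ∂E.trans φ ≤ ∫ x, u x p' ∂E.trans φ' :=
  (integral_mono (hu.integrable_trans hE φ p) (hu.integrable_trans hE φ p')
    fun _ => hu.mono le_rfl hp).trans
    (integral_mono_of_cdf_le (fun a => hE.trans_monotone a hφ) (fun _ _ h => hu.mono h le_rfl)
      (hu.integrable_trans hE φ p') (hu.integrable_trans hE φ' p'))

end IsAdmissible

theorem Standing.isAdmissible_profit (hE : E.Standing δ) : E.IsAdmissible δ E.profit :=
  .of_abs_le hE hE.profit_continuous hE.profit_strictMono.monotone hE.abs_profit_le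

variable (E) in
/-- The Bellman operator of incumbent firms. -/
noncomputable def bellman (v : ℝ≥0 → ℝ≥0 → ℝ) (φ p : ℝ≥0) : ℝ :=
  E.profit φ p + E.discount * max 0 (∫ x, v x p ∂E.trans φ)

/-- The Bellman operator is a contraction of modulus `β / δ` for the weighted supremum norm. -/
theorem abs_bellman_sub_le (hE : E.Standing δ) {u w : ℝ≥0 → ℝ≥0 → ℝ} (hu : E.IsAdmissible δ u)
    (hw : E.IsAdmissible δ w) {C : ℝ} (hC : 0 ≤ C) {p : ℝ≥0}
    (h : ∀ φ, |u φ p - w φ p| ≤ C * (E.weight δ φ p).toReal) (φ : ℝ≥0) :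
    |E.bellman u φ p - E.bellman w φ p| ≤ C * (E.discount / δ) * (E.weight δ φ p).toReal := by
  have hui := hu.integrable_trans hE φ p
  have hwi := hw.integrable_trans hE φ p
  have h1 : |∫ x, u x p ∂E.trans φ - ∫ x, w x p ∂E.trans φ| ≤ C * ((E.weight δ φ p).toReal / δ) := by
    rw [← integral_sub hui hwi]
    refine (abs_integral_le_integral_abs).trans ?_
    refine (integral_mono (hui.sub hwi).abs
      ((hE.integrable_weight (hE.lintegral_weight_trans_lt_top φ p)).const_mul C) h).trans ?_
    rw [integral_const_mul]
    exact mul_le_mul_of_nonneg_left (hE.integral_weight_trans_le φ p) hC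
  have h2 := (abs_max_sub_max_le_abs (∫ x, u x p ∂E.trans φ) (∫ x, w x p ∂E.trans φ) 0).trans h1
  rw [max_comm _ (0 : ℝ), max_comm _ (0 : ℝ)] at h2
  simp only [bellman, add_sub_add_left_eq_sub, ← mul_sub]
  rw [abs_mul, abs_of_pos hE.discount_pos]
  refine (mul_le_mul_of_nonneg_left h2 hE.discount_pos.le).trans (le_of_eq ?_)
  ring

theorem IsAdmissible.bellman (hE : E.Standing δ) {u : ℝ≥0 → ℝ≥0 → ℝ} (hu : E.IsAdmissible δ u) :
    E.IsAdmissible δ (E.bellman u) := by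
  have hzero : E.IsAdmissible δ fun _ _ => 0 :=
    ⟨continuous_const, monotone_const, 0, fun _ _ => by simp⟩
  obtain ⟨K, hK0, hK⟩ := hu.exists_abs_le hE
  refine .of_abs_le hE (K := 1 + |E.shift| + K * (E.discount / δ)) ?_ ?_ fun φ p => ?_
  · exact hE.profit_continuous.add
      (continuous_const.mul (continuous_const.max (hE.trans_continuous u hu)))
  · intro z z' hz
    exact add_le_add (hE.profit_strictMono.monotone hz) (mul_le_mul_of_nonneg_left
      (max_le_max le_rfl (hu.integral_trans_mono hE hz.1 hz.2)) hE.discount_pos.le)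
  · have h := abs_bellman_sub_le hE hu hzero hK0 (p := p) (by simpa using fun φ => hK φ p) φ
    have h0 : E.bellman (fun _ _ => 0) φ p = E.profit φ p := by simp [Industry.bellman]
    rw [h0] at h
    have h1 := hE.abs_profit_le φ p
    have h2 := abs_add_le (E.bellman u φ p - E.profit φ p) (E.profit φ p)
    rw [sub_add_cancel] at h2
    linarith

/-! ### Existence and uniqueness of the value function -/

/-- A limit in the weighted supremum norm of admissible functions is admissible: the weight is
increasing, hence locally bounded, so that the convergence is locally uniform. -/
theorem IsAdmissible.of_tendsto (hE : E.Standing δ) {u : ℕ → ℝ≥0 → ℝ≥0 → ℝ}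
    {v : ℝ≥0 → ℝ≥0 → ℝ} (hu : ∀ n, E.IsAdmissible δ (u n)) {c : ℕ → ℝ} (hc : Tendsto c atTop (𝓝 0))
    (h : ∀ n φ p, |u n φ p - v φ p| ≤ c n * (E.weight δ φ p).toReal) : E.IsAdmissible δ v := by
  have hlim : ∀ φ p, Tendsto (fun n => u n φ p) atTop (𝓝 (v φ p)) := fun φ p => by
    rw [tendsto_iff_dist_tendsto_zero]
    refine squeeze_zero (fun _ => dist_nonneg) (fun n => h n φ p) ?_
    simpa using hc.mul_const (E.weight δ φ p).toReal
  obtain ⟨K, -, hK⟩ := (hu 0).exists_abs_le hE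
  refine .of_abs_le hE (K := K + c 0) ?_ ?_ fun φ p => ?_
  · have hloc : TendstoLocallyUniformly (fun n (z : ℝ≥0 × ℝ≥0) => u n z.1 z.2)
        (fun z => v z.1 z.2) atTop := by
      rw [Metric.tendstoLocallyUniformly_iff]
      intro ε hε z
      refine ⟨Set.Iio (z.1 + 1) ×ˢ Set.Iio (z.2 + 1),
        prod_mem_nhds (Iio_mem_nhds (lt_add_one _)) (Iio_mem_nhds (lt_add_one _)), ?_⟩
      have h0 : Tendsto (fun n => c n * (E.weight δ (z.1 + 1) (z.2 + 1)).toReal) atTop (𝓝 0) := by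
        simpa using hc.mul_const (E.weight δ (z.1 + 1) (z.2 + 1)).toReal
      filter_upwards [h0.eventually (gt_mem_nhds hε)] with n hn y hy
      have hcn : 0 ≤ c n := by
        have := (abs_nonneg _).trans (h n 0 0)
        exact nonneg_of_mul_nonneg_left this (one_pos.trans_le (hE.one_le_weight 0 0))
      rw [dist_comm, Real.dist_eq]
      refine (h n y.1 y.2).trans_lt (lt_of_le_of_lt ?_ hn)
      exact mul_le_mul_of_nonneg_left (ENNReal.toReal_mono (hE.weight_finite _ _).ne
        (hE.weight_mono hy.1.le hy.2.le)) hcn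
    exact hloc.continuous (Frequently.of_forall fun n => (hu n).continuous)
  · exact fun z z' hz => le_of_tendsto_of_tendsto' (hlim _ _) (hlim _ _) fun n => (hu n).monotone hz
  · have h1 := abs_sub_abs_le_abs_sub (v φ p) (u 0 φ p)
    rw [abs_sub_comm] at h1
    have h2 := h 0 φ p
    have h3 := hK φ p
    linarith

theorem IsValueFunction.bellman_eq {v : ℝ≥0 → ℝ≥0 → ℝ} (hv : E.IsValueFunction δ v) :
    E.bellman v = v :=
  funext fun φ => funext fun p => (hv.bellman φ p).symm

theorem Standing.nonpos_of_forall_le (hE : E.Standing δ) {x C : ℝ}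
    (h : ∀ n : ℕ, x ≤ (E.discount / δ) ^ n * C) : x ≤ 0 := by
  have hlim := (tendsto_pow_atTop_nhds_zero_of_lt_one hE.ratio_nonneg hE.ratio_lt_one).mul_const C
  rw [zero_mul] at hlim
  exact ge_of_tendsto' hlim h

theorem IsValueFunction.unique (hE : E.Standing δ) {v w : ℝ≥0 → ℝ≥0 → ℝ}
    (hv : E.IsValueFunction δ v) (hw : E.IsValueFunction δ w) : w = v := by
  obtain ⟨K, hK0, hK⟩ := hv.admissible.exists_abs_le hE
  obtain ⟨L, hL0, hL⟩ := hw.admissible.exists_abs_le hE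
  have hn : ∀ (n : ℕ) (φ p : ℝ≥0),
      |w φ p - v φ p| ≤ ((K + L) * (E.discount / δ) ^ n) * (E.weight δ φ p).toReal := by
    intro n
    induction n with
    | zero =>
      intro φ p
      have := abs_sub (w φ p) (v φ p)
      have := hK φ p
      have := hL φ p
      rw [pow_zero]
      linarith
    | succ n ih =>
      intro φ p
      have h := abs_bellman_sub_le hE hw.admissible hv.admissible
        (mul_nonneg (add_nonneg hK0 hL0) (pow_nonneg hE.ratio_nonneg n)) (fun φ => ih φ p) φ
      rwa [hv.bellman_eq, hw.bellman_eq, mul_assoc (K + L), ← pow_succ] at h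
  refine funext fun φ => funext fun p => sub_eq_zero.1 (abs_nonpos_iff.1 ?_)
  refine hE.nonpos_of_forall_le (C := (K + L) * (E.weight δ φ p).toReal) fun n => ?_
  exact (hn n φ p).trans (le_of_eq (by ring))

theorem Standing.exists_isValueFunction (hE : E.Standing δ) :
    ∃ v, E.IsValueFunction δ v := by
  set ρ := E.discount / δ with hρ
  set K := 1 + |E.shift| with hK
  have hK0 : 0 ≤ K := by positivity
  set u : ℕ → ℝ≥0 → ℝ≥0 → ℝ := fun n => E.bellman^[n] fun _ _ => 0 with hu
  have hsucc : ∀ n, u (n + 1) = E.bellman (u n) := fun n => Function.iterate_succ_apply' _ _ _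
  have hadm : ∀ n, E.IsAdmissible δ (u n) := by
    intro n
    induction n with
    | zero => exact ⟨continuous_const, monotone_const, 0, fun _ _ => by simp [hu]⟩
    | succ n ih => rw [hsucc]; exact ih.bellman hE
  have hstep : ∀ (n : ℕ) (φ p : ℝ≥0),
      |u n φ p - u (n + 1) φ p| ≤ K * ρ ^ n * (E.weight δ φ p).toReal := by
    intro n
    induction n with
    | zero =>
      intro φ p
      simpa [hu, Industry.bellman] using hE.abs_profit_le φ p
    | succ n ih =>
      intro φ p
      have h := abs_bellman_sub_le hE (hadm n) (hadm (n + 1))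
        (mul_nonneg hK0 (pow_nonneg hE.ratio_nonneg n)) (fun φ => ih φ p) φ
      rwa [← hsucc, ← hsucc, mul_assoc K, ← pow_succ] at h
  have hstep' : ∀ (φ p : ℝ≥0) (n : ℕ),
      dist (u n φ p) (u (n + 1) φ p) ≤ K * (E.weight δ φ p).toReal * ρ ^ n := fun φ p n =>
    (hstep n φ p).trans (le_of_eq (by ring))
  have hex : ∀ φ p, ∃ a, Tendsto (fun n => u n φ p) atTop (𝓝 a) := fun φ p =>
    cauchySeq_tendsto_of_complete (cauchySeq_of_le_geometric ρ _ hE.ratio_lt_one (hstep' φ p))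
  choose v hv using hex
  set c : ℕ → ℝ := fun n => K * ρ ^ n / (1 - ρ) with hc
  have hdist : ∀ n φ p, |u n φ p - v φ p| ≤ c n * (E.weight δ φ p).toReal := fun n φ p =>
    (dist_le_of_le_geometric_of_tendsto ρ _ hE.ratio_lt_one (hstep' φ p) (hv φ p) n).trans
      (le_of_eq (by rw [hc]; ring))
  have hc0 : Tendsto c atTop (𝓝 0) := by
    have := ((tendsto_pow_atTop_nhds_zero_of_lt_one hE.ratio_nonneg
      hE.ratio_lt_one).const_mul K).div_const (1 - ρ)
    simpa [hc] using this
  have hcn : ∀ n, 0 ≤ c n := fun n =>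
    div_nonneg (mul_nonneg hK0 (pow_nonneg hE.ratio_nonneg n)) (sub_pos.2 hE.ratio_lt_one).le
  have hvadm : E.IsAdmissible δ v := .of_tendsto hE hadm hc0 hdist
  refine ⟨v, hvadm, fun φ p => ?_⟩
  have h1 : Tendsto (fun n => u (n + 1) φ p) atTop (𝓝 (v φ p)) :=
    (hv φ p).comp (tendsto_add_atTop_nat 1)
  have h2 : Tendsto (fun n => u (n + 1) φ p) atTop (𝓝 (E.bellman v φ p)) := by
    rw [tendsto_iff_dist_tendsto_zero]
    refine squeeze_zero (fun _ => dist_nonneg) (fun n => ?_)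
      (g := fun n => c n * ρ * (E.weight δ φ p).toReal) ?_
    · rw [hsucc, Real.dist_eq]
      exact abs_bellman_sub_le hE (hadm n) hvadm (hcn n) (fun φ => hdist n φ p) φ
    · simpa using (hc0.mul_const ρ).mul_const (E.weight δ φ p).toReal
  exact tendsto_nhds_unique h1 h2

namespace IsValueFunction

variable {v : ℝ≥0 → ℝ≥0 → ℝ}

/-! ### The entry price -/

theorem profit_le (hE : E.Standing δ) (hv : E.IsValueFunction δ v) (φ p : ℝ≥0) :
    E.profit φ p ≤ v φ p := by
  rw [hv.bellman φ p]
  exact le_add_of_nonneg_right (mul_nonneg hE.discount_pos.le (le_max_left _ _))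

theorem strictMono_price (hE : E.Standing δ) (hv : E.IsValueFunction δ v) (φ : ℝ≥0) :
    StrictMono (v φ) := by
  intro p p' h
  rw [hv.bellman φ p, hv.bellman φ p']
  exact add_lt_add_of_lt_of_le
    (hE.profit_strictMono (a := (φ, p)) (b := (φ, p')) (Prod.mk_lt_mk_of_le_of_lt le_rfl h))
    (mul_le_mul_of_nonneg_left
      (max_le_max le_rfl (hv.admissible.integral_trans_mono hE le_rfl h.le)) hE.discount_pos.le)

theorem integral_lt_integral (hE : E.Standing δ) (hv : E.IsValueFunction δ v) {p p' : ℝ≥0}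
    (h : p < p') {μ : Measure ℝ≥0} [IsProbabilityMeasure μ]
    (hμ : ∀ q, ∫⁻ x, E.weight δ x q ∂μ < ⊤) : ∫ x, v x p ∂μ < ∫ x, v x p' ∂μ := by
  have hlt : ∀ x, 0 < v x p' - v x p := fun x => sub_pos.2 (hv.strictMono_price hE x h)
  have hi := hv.admissible.integrable hE (hμ p)
  have hi' := hv.admissible.integrable hE (hμ p')
  have hsupp : Function.support (fun x => v x p' - v x p) = Set.univ :=
    Set.eq_univ_of_forall fun x => (hlt x).ne'
  have := (integral_pos_iff_support_of_nonneg (fun x => (hlt x).le) (hi'.sub hi)).2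
    (by rw [hsupp, measure_univ]; exact one_pos)
  rwa [integral_sub hi' hi, sub_pos] at this

/-- At the price zero profits are negative at every productivity level, so no firm has positive
value: the positive part of the value is at most `(β / δ)ⁿ` times a multiple of the weight. -/
theorem value_zero_neg (hE : E.Standing δ) (hv : E.IsValueFunction δ v) (φ : ℝ≥0) :
    v φ 0 < 0 := by
  have hπ : ∀ φ, E.profit φ 0 < 0 := fun φ => hE.profit_neg φ 0 (Or.inr rfl)
  obtain ⟨K, hK0, hK⟩ := hv.admissible.exists_abs_le hE
  have hn : ∀ (n : ℕ) (φ : ℝ≥0),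
      v φ 0 ≤ K * (E.discount / δ) ^ n * (E.weight δ φ 0).toReal := by
    intro n
    induction n with
    | zero => intro φ; rw [pow_zero, mul_one]; exact (le_abs_self _).trans (hK φ 0)
    | succ n ih =>
      intro φ
      have hC : 0 ≤ K * (E.discount / δ) ^ n := mul_nonneg hK0 (pow_nonneg hE.ratio_nonneg n)
      have h1 : ∫ x, v x 0 ∂E.trans φ ≤
          K * (E.discount / δ) ^ n * ((E.weight δ φ 0).toReal / δ) := by
        refine (integral_mono (hv.admissible.integrable_trans hE φ 0)
          ((hE.integrable_weight (hE.lintegral_weight_trans_lt_top φ 0)).const_mul _) ih).trans ?_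
        rw [integral_const_mul]
        exact mul_le_mul_of_nonneg_left (hE.integral_weight_trans_le φ 0) hC
      have h2 := max_le (mul_nonneg hC (div_nonneg ENNReal.toReal_nonneg hE.delta_pos.le)) h1
      have h3 := mul_le_mul_of_nonneg_left h2 hE.discount_pos.le
      rw [hv.bellman φ 0]
      refine (add_le_add (hπ φ).le h3).trans (le_of_eq ?_)
      ring
  have hle : ∀ φ, v φ 0 ≤ 0 := fun φ =>
    hE.nonpos_of_forall_le (C := K * (E.weight δ φ 0).toReal) fun n =>
      (hn n φ).trans (le_of_eq (by ring))
  rw [hv.bellman φ 0, max_eq_left (integral_nonpos fun x => hle x), mul_zero, add_zero]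
  exact hπ φ

theorem continuous_entrant_value (hE : E.Standing δ) (hv : E.IsValueFunction δ v) :
    Continuous fun p => ∫ x, v x p ∂E.entrant := by
  obtain ⟨K, hK0, hK⟩ := hv.admissible.exists_abs_le hE
  refine continuous_iff_continuousAt.2 fun p₀ => ?_
  refine continuousAt_of_dominated (bound := fun x => K * (E.weight δ x (p₀ + 1)).toReal)
    (Eventually.of_forall fun p =>
      (hv.admissible.continuous_left p).measurable.aestronglyMeasurable) ?_
    ((hE.integrable_weight (hE.lintegral_weight_entrant_lt_top _)).const_mul K)
    (ae_of_all _ fun x => (hv.admissible.continuous.comp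
      (by fun_prop : Continuous fun p : ℝ≥0 => (x, p))).continuousAt)
  filter_upwards [Iio_mem_nhds (lt_add_one p₀)] with p hp
  exact ae_of_all _ fun x => (hK x p).trans (mul_le_mul_of_nonneg_left
    (ENNReal.toReal_mono (hE.weight_finite _ _).ne (hE.weight_mono le_rfl (le_of_lt hp))) hK0)

theorem entryPrice_unique (hE : E.Standing δ) (hv : E.IsValueFunction δ v) {p p' : ℝ≥0}
    (h : E.IsEntryPrice v p) (h' : E.IsEntryPrice v p') : p = p' := by
  have hmono : StrictMono fun p => ∫ x, v x p ∂E.entrant := fun p p' h =>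
    hv.integral_lt_integral hE h hE.lintegral_weight_entrant_lt_top
  exact hmono.injective (h.2.trans h'.2.symm)

/-- The expected value of an entrant is negative at the price zero and at least the cost of entry at
the price where one period of profits already covers it; it is continuous in between. -/
theorem exists_entryPrice (hE : E.Standing δ) (hv : E.IsValueFunction δ v) :
    ∃ p, E.IsEntryPrice v p := by
  obtain ⟨p₁, hp₁, hge⟩ := hE.entrant_profit
  have hint : ∀ p, Integrable (fun x => v x p) E.entrant := fun p =>
    hv.admissible.integrable hE (hE.lintegral_weight_entrant_lt_top p)
  have h0 : ∫ x, v x 0 ∂E.entrant ≤ 0 := integral_nonpos fun x => (hv.value_zero_neg hE x).le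
  have h1 : E.entryCost ≤ ∫ x, v x p₁ ∂E.entrant :=
    hge.trans (integral_mono (hE.isAdmissible_profit.integrable hE
      (hE.lintegral_weight_entrant_lt_top p₁)) (hint p₁) fun x => hv.profit_le hE x p₁)
  obtain ⟨p, -, hp⟩ := intermediate_value_Icc (zero_le (a := p₁))
    (hv.continuous_entrant_value hE).continuousOn ⟨h0.trans hE.entryCost_pos.le, h1⟩
  refine ⟨p, pos_iff_ne_zero.2 ?_, hp⟩
  rintro rfl
  exact (h0.trans_lt hE.entryCost_pos).ne hp

end IsValueFunction

/-! ### The exit threshold -/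

theorem Standing.summable_discounted_profit (hE : E.Standing δ) (φ p : ℝ≥0) :
    Summable fun t : ℕ => E.discount ^ t * ∫ x, E.profit x p ∂(E.trans ^ t) φ := by
  refine Summable.of_norm_bounded (g := fun t =>
    (1 + |E.shift|) * (E.weight δ φ p).toReal * (E.discount / δ) ^ t)
    ((summable_geometric_of_lt_one hE.ratio_nonneg hE.ratio_lt_one).mul_left _) fun t => ?_
  have hδ := pow_pos hE.delta_pos t
  have hwi := hE.integrable_weight (hE.lintegral_weight_pow_lt_top t φ p)
  have h1 : |∫ x, E.profit x p ∂(E.trans ^ t) φ| ≤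
      (1 + |E.shift|) * ((E.weight δ φ p).toReal / δ ^ t) := by
    refine abs_integral_le_integral_abs.trans ((integral_mono (hE.isAdmissible_profit.integrable hE
      (hE.lintegral_weight_pow_lt_top t φ p)).abs (hwi.const_mul _)
        fun x => hE.abs_profit_le x p).trans ?_)
    rw [integral_const_mul]
    exact mul_le_mul_of_nonneg_left ((le_div_iff₀' hδ).2 (hE.integral_weight_pow_le t φ p))
      (by positivity)
  rw [Real.norm_eq_abs, abs_mul, abs_of_nonneg (pow_nonneg hE.discount_pos.le t)]
  refine (mul_le_mul_of_nonneg_left h1 (pow_nonneg hE.discount_pos.le t)).trans (le_of_eq ?_)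
  rw [div_pow]
  ring

namespace IsValueFunction

variable {v : ℝ≥0 → ℝ≥0 → ℝ}

/-- If continuing is worthwhile at the productivity level zero, then no firm ever exits, and the
value of continuing is the discounted sum of future profits. -/
theorem discount_mul_continuation_zero (hE : E.Standing δ) (hv : E.IsValueFunction δ v) {p : ℝ≥0}
    (h : 0 ≤ ∫ x, v x p ∂E.trans 0) :
    E.discount * ∫ x, v x p ∂E.trans 0 =
      ∑' t : ℕ, E.discount ^ (t + 1) * ∫ x, E.profit x p ∂(E.trans ^ (t + 1)) 0 := by
  have hint : ∀ t : ℕ, Integrable (fun x => v x p) ((E.trans ^ t) 0) := fun t =>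
    hv.admissible.integrable hE (hE.lintegral_weight_pow_lt_top t 0 p)
  set J : ℕ → ℝ := fun t => ∫ x, v x p ∂(E.trans ^ t) 0 with hJ
  have hcomp : ∀ t, (E.trans ^ (t + 1)) 0 = (E.trans ∘ₖ (E.trans ^ t)) 0 := fun t => by
    rw [pow_succ']; rfl
  have hrec : ∀ t, J t = ∫ x, E.profit x p ∂(E.trans ^ t) 0 + E.discount * J (t + 1) := by
    intro t
    have hi := hint (t + 1)
    rw [hcomp] at hi
    simp only [hJ, hcomp t]
    rw [Kernel.integral_comp hi, ← integral_const_mul,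
      ← integral_add (hE.isAdmissible_profit.integrable hE (hE.lintegral_weight_pow_lt_top t 0 p))
        (hi.integral_comp.const_mul _)]
    refine integral_congr_ae (ae_of_all _ fun x => ?_)
    simp only
    rw [hv.bellman x p, max_eq_right (h.trans (hv.admissible.integral_trans_mono hE zero_le le_rfl))]
  have hpart : ∀ n : ℕ, ∑ t ∈ Finset.range n,
      E.discount ^ (t + 1) * ∫ x, E.profit x p ∂(E.trans ^ (t + 1)) 0 =
        E.discount * J 1 - E.discount ^ (n + 1) * J (n + 1) := by
    intro n
    induction n with
    | zero => simp
    | succ n ih => rw [Finset.sum_range_succ, ih, hrec (n + 1)]; ring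
  obtain ⟨K, hK0, hK⟩ := hv.admissible.exists_abs_le hE
  have hJle : ∀ n, |E.discount ^ n * J n| ≤ K * (E.weight δ 0 p).toReal * (E.discount / δ) ^ n := by
    intro n
    have h1 : |J n| ≤ K * ((E.weight δ 0 p).toReal / δ ^ n) := by
      refine abs_integral_le_integral_abs.trans ((integral_mono (hint n).abs
        ((hE.integrable_weight (hE.lintegral_weight_pow_lt_top n 0 p)).const_mul _)
          fun x => hK x p).trans ?_)
      rw [integral_const_mul]
      exact mul_le_mul_of_nonneg_left
        ((le_div_iff₀' (pow_pos hE.delta_pos n)).2 (hE.integral_weight_pow_le n 0 p)) hK0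
    rw [abs_mul, abs_of_nonneg (pow_nonneg hE.discount_pos.le n)]
    refine (mul_le_mul_of_nonneg_left h1 (pow_nonneg hE.discount_pos.le n)).trans (le_of_eq ?_)
    rw [div_pow]
    ring
  -- The remainder `βⁿ Γⁿv` vanishes since `v` is bounded by the weight and `β < δ`.
  have hJ0 : Tendsto (fun n => E.discount ^ n * J n) atTop (𝓝 0) := by
    refine squeeze_zero_norm hJle ?_
    simpa using (tendsto_pow_atTop_nhds_zero_of_lt_one hE.ratio_nonneg
      hE.ratio_lt_one).const_mul (K * (E.weight δ 0 p).toReal)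
  have hsum := ((summable_nat_add_iff 1).2 (hE.summable_discounted_profit 0 p)).hasSum.tendsto_sum_nat
  have hlim := (hJ0.comp (tendsto_add_atTop_nat 1)).const_sub (E.discount * J 1)
  simp only [hpart] at hsum
  rw [tendsto_nhds_unique hsum hlim, sub_zero, hJ]
  simp

/-- A firm with productivity zero exits. By assumption its expected discounted profits from staying forever
are nonpositive at every price; since the value is strictly increasing in the price, continuing
cannot be worthwhile at `p`, as it would then have positive value at `p + 1`. -/
theorem continuation_zero_neg (hE : E.Standing δ) (hv : E.IsValueFunction δ v) (p : ℝ≥0) :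
    ∫ x, v x p ∂E.trans 0 < 0 := by
  by_contra! h
  have h1 : 0 < ∫ x, v x (p + 1) ∂E.trans 0 := h.trans_lt
    (hv.integral_lt_integral hE (lt_add_one p) fun q => hE.lintegral_weight_trans_lt_top 0 q)
  have h2 := hv.discount_mul_continuation_zero hE h1.le
  have h3 := hE.profit_zero (p + 1)
  rw [← h2] at h3
  exact (mul_pos hE.discount_pos h1).not_ge h3

/-- At a positive price the exit threshold is positive and finite. -/
theorem exists_threshold_eq (hE : E.Standing δ) (hv : E.IsValueFunction δ v) {p : ℝ≥0}
    (hp : 0 < p) : ∃ a : ℝ≥0, 0 < a ∧ E.threshold v p = a := by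
  set g : ℝ≥0 → ℝ := fun φ => ∫ x, v x p ∂E.trans φ with hg
  have hgc : Continuous g := (hE.trans_continuous v hv.admissible).comp
    (by fun_prop : Continuous fun φ : ℝ≥0 => (φ, p))
  obtain ⟨φ₀, hφ₀⟩ := hE.trans_profit p hp
  have hne : {φ | 0 ≤ g φ}.Nonempty := ⟨φ₀, hφ₀.trans (integral_mono
    (hE.isAdmissible_profit.integrable_trans hE φ₀ p) (hv.admissible.integrable_trans hE φ₀ p)
    fun x => hv.profit_le hE x p)⟩
  have hmem : 0 ≤ g (sInf {φ | 0 ≤ g φ}) :=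
    (isClosed_le continuous_const hgc).csInf_mem hne (OrderBot.bddBelow _)
  refine ⟨sInf {φ | 0 ≤ g φ}, pos_iff_ne_zero.2 fun h0 => ?_, ?_⟩
  · rw [h0] at hmem
    exact (hv.continuation_zero_neg hE p).not_ge hmem
  · rw [ENNReal.coe_sInf hne, threshold, sInf_image]

end IsValueFunction

/-! ### Stationary equilibria -/

variable {v : ℝ≥0 → ℝ≥0 → ℝ}

namespace Standing

theorem demand_pos (hE : E.Standing δ) (p : ℝ≥0) : 0 < E.demand p :=
  (zero_le (a := E.demand (p + 1))).trans_lt (hE.demand_strictAnti (lt_add_one p))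

theorem demand_lt_top (hE : E.Standing δ) {p : ℝ≥0} (hp : 0 < p) : E.demand p < ⊤ :=
  hE.demand_zero ▸ hE.demand_strictAnti hp

theorem measurable_output (hE : E.Standing δ) (p : ℝ≥0) :
    Measurable fun x => (E.output x p : ℝ≥0∞) :=
  (hE.output_continuous.comp
    (by fun_prop : Continuous fun φ : ℝ≥0 => (φ, p))).measurable.coe_nnreal_ennreal

theorem output_pos (hE : E.Standing δ) {p : ℝ≥0} (hp : 0 < p) : 0 < E.output 0 p :=
  (zero_le (a := E.output 0 0)).trans_lt
    (hE.output_strictMono (a := (0, 0)) (b := (0, p)) (Prod.mk_lt_mk_of_le_of_lt le_rfl hp))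

theorem output_zero_mul_le (hE : E.Standing δ) (p : ℝ≥0) (μ : Measure ℝ≥0) :
    (E.output 0 p : ℝ≥0∞) * μ Set.univ ≤ ∫⁻ x, (E.output x p : ℝ≥0∞) ∂μ := by
  rw [← lintegral_const]
  exact lintegral_mono fun x => ENNReal.coe_le_coe.2
    (hE.output_strictMono.monotone (a := (0, p)) (b := (x, p)) ⟨zero_le, le_rfl⟩)

/-- From every productivity level, the chain reaches levels below `a > 0` with positive
probability. -/
theorem exists_pow_compl_pos (hE : E.Standing δ) {a : ℝ≥0} (ha : 0 < a) (φ : ℝ≥0) :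
    ∃ n : ℕ, 0 < (E.trans ^ n) φ (Set.Ici a)ᶜ := by
  rw [Set.compl_Ici]
  exact hE.trans_recurrent a ha φ

end Standing

open Classical in
/-- The distribution of firms in an industry with exit threshold `a`, per unit mass of entrants:
the expected time that a firm spends at each productivity level before it exits. -/
noncomputable def firmMeasure (E : Industry) (a : ℝ≥0) : Measure ℝ≥0 :=
  Kernel.occupation E.entrant (E.trans.killed (A := Set.Ici a) measurableSet_Ici)

theorem expectedLifetimeSum_eq_firmMeasure {p a : ℝ≥0} (ha : E.threshold v p = a)
    {f : ℝ≥0 → ℝ≥0∞} (hf : Measurable f) :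
    E.expectedLifetimeSum v p f = ∫⁻ x, f x ∂E.firmMeasure a := by
  classical
  exact E.expectedLifetimeSum_eq v p measurableSet_Ici (fun φ => by simp [ha]) hf

theorem expectedLifetimeOutput_pos (hE : E.Standing δ) {p a : ℝ≥0} (hp : 0 < p)
    (ha : E.threshold v p = a) : 0 < E.expectedLifetimeOutput v p := by
  classical
  rw [expectedLifetimeOutput, expectedLifetimeSum_eq_firmMeasure ha (hE.measurable_output p)]
  refine lt_of_lt_of_le ?_ (hE.output_zero_mul_le p _)
  refine ENNReal.mul_pos (ENNReal.coe_pos.2 (hE.output_pos hp)).ne' fun h => ?_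
  have h1 := Kernel.le_occupation E.entrant (E.trans.killed (A := Set.Ici a) measurableSet_Ici) Set.univ
  rw [← firmMeasure, h, measure_univ] at h1
  exact one_pos.not_ge h1

namespace IsEquilibrium

variable {p a : ℝ≥0} {μ : Measure ℝ≥0} {M : ℝ≥0}

theorem eq_smul_firmMeasure (hE : E.Standing δ) (h : E.IsEquilibrium v p μ M) (ha0 : 0 < a)
    (ha : E.threshold v p = a) : μ = (M : ℝ≥0∞) • E.firmMeasure a := by
  classical
  have := h.finite
  set Q := E.trans.killed (A := Set.Ici a) measurableSet_Ici with hQ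
  have hset : {φ : ℝ≥0 | E.threshold v p ≤ φ} = Set.Ici a := by ext φ; simp [ha]
  have hμ : μ = μ.bind Q + (M : ℝ≥0∞) • E.entrant := by
    ext B hB
    rw [Measure.add_apply, hQ, Kernel.killed_comp_apply _ _ _ hB, h.invariant B hB, hset]
    rfl
  rw [Kernel.eq_occupation_of_eq_bind_killed_add _ _ (hE.exists_pow_compl_pos ha0) _ μ hμ, ← hQ]
  ext B hB
  rw [Measure.smul_apply, firmMeasure, Kernel.occupation, Kernel.occupation,
    Measure.sum_apply _ hB, Measure.sum_apply _ hB, smul_eq_mul, ← ENNReal.tsum_mul_left]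
  refine tsum_congr fun n => ?_
  rw [Measure.comp_smul]
  rfl

/-- Without entrants the measure of firms vanishes, and so does supply; demand does not. -/
theorem mass_pos (hE : E.Standing δ) (h : E.IsEquilibrium v p μ M) (ha0 : 0 < a)
    (ha : E.threshold v p = a) : 0 < M := by
  rw [pos_iff_ne_zero]
  rintro rfl
  have h1 := h.market
  rw [h.eq_smul_firmMeasure hE ha0 ha] at h1
  simp only [ENNReal.coe_zero, zero_smul, lintegral_zero_measure] at h1
  exact (hE.demand_pos p).ne h1

/-- Market clearing determines the mass of entrants: supply is the mass of entrants times their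
expected lifetime output. -/
theorem mass_mul_expectedLifetimeOutput (hE : E.Standing δ) (h : E.IsEquilibrium v p μ M)
    (ha0 : 0 < a) (ha : E.threshold v p = a) :
    (M : ℝ≥0∞) * E.expectedLifetimeOutput v p = E.demand p := by
  rw [expectedLifetimeOutput, expectedLifetimeSum_eq_firmMeasure ha (hE.measurable_output p),
    ← h.market, h.eq_smul_firmMeasure hE ha0 ha, lintegral_smul_measure]
  rfl

end IsEquilibrium

/-- If expected lifetime output is finite at the entry price, then the mass of entrants that clears
the market, together with the occupation measure scaled by it, is an equilibrium. -/
theorem isEquilibrium_of_expectedLifetimeOutput_lt_top (hE : E.Standing δ) {p a : ℝ≥0}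
    (hp : E.IsEntryPrice v p) (ha : E.threshold v p = a)
    (hfin : E.expectedLifetimeOutput v p < ⊤) :
    E.IsEquilibrium v p (((E.demand p / E.expectedLifetimeOutput v p).toNNReal : ℝ≥0∞) • E.firmMeasure a)
      (E.demand p / E.expectedLifetimeOutput v p).toNNReal := by
  classical
  have hpos := expectedLifetimeOutput_pos hE hp.1 ha
  set M := (E.demand p / E.expectedLifetimeOutput v p).toNNReal with hM
  have hMcoe : (M : ℝ≥0∞) = E.demand p / E.expectedLifetimeOutput v p :=
    ENNReal.coe_toNNReal (ENNReal.div_lt_top (hE.demand_lt_top hp.1).ne hpos.ne').ne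
  set Q := E.trans.killed (A := Set.Ici a) measurableSet_Ici with hQ
  set μ := (M : ℝ≥0∞) • E.firmMeasure a with hμ
  have hset : {φ : ℝ≥0 | E.threshold v p ≤ φ} = Set.Ici a := by ext φ; simp [ha]
  have hmarket : ∫⁻ φ, (E.output φ p : ℝ≥0∞) ∂μ = E.demand p := by
    have h1 : ∫⁻ φ, (E.output φ p : ℝ≥0∞) ∂μ = M * E.expectedLifetimeOutput v p := by
      rw [expectedLifetimeOutput, expectedLifetimeSum_eq_firmMeasure ha (hE.measurable_output p),
        hμ, lintegral_smul_measure]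
      rfl
    rw [h1, hMcoe, ENNReal.div_mul_cancel hpos.ne' hfin.ne]
  -- Output is bounded below by `q(0, p) > 0`, so finite supply requires a finite mass of firms.
  have hμfin : IsFiniteMeasure μ := by
    refine ⟨lt_of_not_ge fun htop => ?_⟩
    have h1 := hE.output_zero_mul_le p μ
    rw [top_le_iff.1 htop, ENNReal.mul_top (ENNReal.coe_pos.2 (hE.output_pos hp.1)).ne',
      hmarket] at h1
    exact (hE.demand_lt_top hp.1).not_ge h1
  have hinv : ∀ B : Set ℝ≥0, MeasurableSet B →
      μ B = (∫⁻ φ, (Set.Ici a).indicator (fun φ => E.trans φ B) φ ∂μ) + M * E.entrant B := by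
    intro B hB
    rw [← Kernel.killed_comp_apply measurableSet_Ici _ _ hB, ← hQ, hμ]
    have h1 := congrArg (fun m : Measure ℝ≥0 => (M : ℝ≥0∞) • m B) (Kernel.occupation_eq E.entrant Q)
    simp only [Measure.add_apply, smul_add] at h1
    rw [Measure.comp_smul, Measure.smul_apply, Measure.smul_apply]
    exact h1
  refine ⟨hp.1, hμfin, hp.2.le, fun _ => hp.2, fun B hB => by rw [hset]; exact hinv B hB, ?_,
    hmarket⟩
  -- Balanced entry and exit is the invariance of total mass, which is finite.
  have hcompl : {φ : ℝ≥0 | (φ : ℝ≥0∞) < E.threshold v p} = (Set.Ici a)ᶜ := by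
    ext φ; simp [ha]
  have h1 := hinv Set.univ MeasurableSet.univ
  simp only [measure_univ, mul_one] at h1
  rw [lintegral_indicator measurableSet_Ici, setLIntegral_const, one_mul,
    ← measure_add_measure_compl (measurableSet_Ici (a := a))] at h1
  rw [hcompl]
  exact ((ENNReal.add_right_inj (measure_ne_top μ _)).1 h1).symm

end Industry

theorem theorem1 (E : Industry) (δ : ℝ) (hE : E.Standing δ) :
    ∃ v : ℝ≥0 → ℝ≥0 → ℝ,
      -- `v` is the value function
      E.IsValueFunction δ v ∧ (∀ w, E.IsValueFunction δ w → w = v) ∧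
      ∃ pstar : ℝ≥0,
        -- `pstar` is the unique price consistent with the entry condition
        E.IsEntryPrice v pstar ∧ (∀ p, E.IsEntryPrice v p → p = pstar) ∧
        -- an equilibrium exists if and only if expected lifetime output is finite
        (E.expectedLifetimeOutput v pstar < ⊤ ↔
          ∃ (p : ℝ≥0) (μ : Measure ℝ≥0) (M : ℝ≥0), E.IsEquilibrium v p μ M) ∧
        -- the equilibrium is unique
        (∀ (p₁ p₂ : ℝ≥0) (μ₁ μ₂ : Measure ℝ≥0) (M₁ M₂ : ℝ≥0),
          E.IsEquilibrium v p₁ μ₁ M₁ → E.IsEquilibrium v p₂ μ₂ M₂ →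
            p₁ = p₂ ∧ μ₁ = μ₂ ∧ M₁ = M₂) ∧
        -- the price, the mass of entrants and the distribution in equilibrium
        (∀ (p : ℝ≥0) (μ : Measure ℝ≥0) (M : ℝ≥0), E.IsEquilibrium v p μ M →
          p = pstar ∧ 0 < M ∧
            ∀ B : Set ℝ≥0, MeasurableSet B →
              μ B = M * E.expectedLifetimeSum v pstar (B.indicator 1)) := by
  obtain ⟨v, hv⟩ := hE.exists_isValueFunction
  obtain ⟨pstar, hp⟩ := hv.exists_entryPrice hE
  obtain ⟨a, ha0, ha⟩ := hv.exists_threshold_eq hE hp.1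
  have hprice : ∀ {p μ M}, E.IsEquilibrium v p μ M → p = pstar := by
    intro p μ M h
    obtain ⟨c, hc0, hc⟩ := hv.exists_threshold_eq hE h.price_pos
    exact hv.entryPrice_unique hE ⟨h.price_pos, h.entry_eq (h.mass_pos hE hc0 hc)⟩ hp
  have hpos := Industry.expectedLifetimeOutput_pos hE hp.1 ha
  refine ⟨v, hv, fun w hw => hv.unique hE hw, pstar, hp, fun p h => hv.entryPrice_unique hE h hp,
    ⟨fun hfin => ⟨_, _, _, Industry.isEquilibrium_of_expectedLifetimeOutput_lt_top hE hp ha hfin⟩,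
      ?_⟩, ?_, ?_⟩
  · rintro ⟨p, μ, M, h⟩
    obtain rfl := hprice h
    by_contra! htop
    have h1 := h.mass_mul_expectedLifetimeOutput hE ha0 ha
    rw [top_le_iff.1 htop, ENNReal.mul_top (ENNReal.coe_pos.2 (h.mass_pos hE ha0 ha)).ne'] at h1
    exact (hE.demand_lt_top hp.1).ne h1.symm
  · intro p₁ p₂ μ₁ μ₂ M₁ M₂ h₁ h₂
    obtain rfl := hprice h₁
    obtain rfl := hprice h₂
    have e₁ := h₁.mass_mul_expectedLifetimeOutput hE ha0 ha
    have e₂ := h₂.mass_mul_expectedLifetimeOutput hE ha0 ha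
    have hfin : E.expectedLifetimeOutput v p₂ ≠ ⊤ := by
      intro htop
      rw [htop, ENNReal.mul_top (ENNReal.coe_pos.2 (h₁.mass_pos hE ha0 ha)).ne'] at e₁
      exact (hE.demand_lt_top hp.1).ne e₁.symm
    have hM : M₁ = M₂ :=
      ENNReal.coe_injective ((ENNReal.mul_left_inj hpos.ne' hfin).1 (e₁.trans e₂.symm))
    refine ⟨rfl, ?_, hM⟩
    rw [h₁.eq_smul_firmMeasure hE ha0 ha, h₂.eq_smul_firmMeasure hE ha0 ha, hM]
  · intro p μ M h
    obtain rfl := hprice h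
    refine ⟨rfl, h.mass_pos hE ha0 ha, fun B hB => ?_⟩
    rw [Industry.expectedLifetimeSum_eq_firmMeasure ha (measurable_one.indicator hB),
      lintegral_indicator_one hB]
    conv_lhs => rw [h.eq_smul_firmMeasure hE ha0 ha]
    rfl
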